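/- Let $p$ be an odd prime with $p\neq 3$. For integers $b,c$ let $$D_p(b,c)=\det\big[(i^2+bij+cj^2)^{p-2}\big]_{1\le i,j\le p-1},$$ and let $\left(\frac{\cdot}{\cdot}\right)$ denote the Legendre symbol. If $\left(\frac{p}{7}\right)=-1$ and $p\not\equiv 15\pmod{16}$, then $$\left(\frac{D_p(1,16)}{p}\right)=\left(\frac{-2}{p}\right).$$ -/

import Mathlib

/-- The determinant of the `(p-1) × (p-1)` integer matrix with entries
`(i² + b i j + c j²)^(p-2)`, for `1 ≤ i, j ≤ p - 1`. An index `i : Fin (p - 1)` starts at `0`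
and stands for the integer `i + 1`. -/
def sunDet (p : ℕ) (b c : ℤ) : ℤ :=
  Matrix.det (Matrix.of fun i j : Fin (p - 1) =>
    ((((i : ℕ) : ℤ) + 1) ^ 2 + b * (((i : ℕ) : ℤ) + 1) * (((j : ℕ) : ℤ) + 1)
      + c * (((j : ℕ) : ℤ) + 1) ^ 2) ^ (p - 2))

instance factPrimeSeven : Fact (Nat.Prime 7) := ⟨by norm_num⟩

/-! Modulo `p` the entries are inverses of a binary form, homogeneous of degree -2, so a Vandermonde
matrix diagonalises the determinant into `∏ λ_k` with `λ_k = ∑ x^k / (x² + x + 16)` (`sunDet_cast`).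
The discriminant is `-63 = 9 · (-7)` and `p` is inert in `ℚ(√-7)`, so Frobenius swaps the roots `a`,
`b`, and partial fractions give `63 λ_k = a^k + b^k`. As `ab = 16` is a square, the terms `k` and `p
+ 1 - k` agree up to squares, leaving only `k = 1` and `k = (p + 1) / 2`
(`quadraticChar_prod_of_symm`). These are explicit because `a = -t^4` with `t² = t - 2`. No term
vanishes, since `a / b` has odd order (`exists_odd_pow_eq`); this is where `p ≢ 15 (mod 16)` enters.
-/

/-- Summing over `1, …, p - 1` is summing over all of `ZMod p` when the value at `0` vanishes. -/
theorem sum_fin_pred_eq_sum_zmod {p : ℕ} [Fact p.Prime] {M : Type*} [AddCommMonoid M]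
    (g : ZMod p → M) (h0 : g 0 = 0) :
    ∑ i : Fin (p - 1), g (((i : ℕ) : ZMod p) + 1) = ∑ x : ZMod p, g x := by
  have hp : 1 ≤ p := (Fact.out : p.Prime).one_lt.le
  refine Finset.sum_of_injOn (fun i : Fin (p - 1) => ((i : ℕ) : ZMod p) + 1) ?_ (by simp) ?_ (by simp)
  · intro i _ j _ hij
    have h : ((i : ℕ) : ZMod p) = ((j : ℕ) : ZMod p) := add_right_cancel hij
    rw [ZMod.natCast_eq_natCast_iff'] at h
    have hi := i.2
    have hj := j.2
    rw [Nat.mod_eq_of_lt (by omega), Nat.mod_eq_of_lt (by omega)] at h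
    exact Fin.ext h
  · intro x _ hx
    by_cases h : x = 0
    · rw [h, h0]
    · exfalso
      apply hx
      have hlt := ZMod.val_lt x
      have hpos : x.val ≠ 0 := fun h' => h ((ZMod.val_eq_zero x).1 h')
      refine ⟨⟨x.val - 1, by omega⟩, by simp, ?_⟩
      have : ((x.val - 1 : ℕ) : ZMod p) + 1 = ((x.val - 1 + 1 : ℕ) : ZMod p) := by push_cast; rfl
      simp only [this]
      rw [Nat.sub_add_cancel (by omega)]
      exact ZMod.natCast_zmod_val x

theorem natCast_add_one_ne_zero_of_fin {p : ℕ} (i : Fin (p - 1)) :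
    ((i : ℕ) : ZMod p) + 1 ≠ 0 := by
  intro h
  have h' : ((i + 1 : ℕ) : ZMod p) = 0 := by push_cast; exact h
  rw [ZMod.natCast_eq_zero_iff] at h'
  have := Nat.le_of_dvd (by omega) h'
  have := i.2
  omega

theorem zmod_pow_sub_two {p : ℕ} [Fact p.Prime] (hp2 : p ≠ 2) (u : ZMod p) :
    u ^ (p - 2) = u⁻¹ := by
  have h2 := (Fact.out : p.Prime).two_le
  by_cases hu : u = 0
  · rw [hu, inv_zero, zero_pow (by omega)]
  · refine eq_inv_of_mul_eq_one_left ?_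
    rw [← pow_succ, show p - 2 + 1 = p - 1 by omega]
    exact ZMod.pow_card_sub_one_eq_one hu

/-- The Vandermonde-type matrix `(j + 1) ^ (k + 1)` diagonalises the matrix of inverse values of a
binary quadratic form modulo `p`. -/
theorem sunDet_cast {p : ℕ} [Fact p.Prime] (hp2 : p ≠ 2) (b c : ℤ) :
    (sunDet p b c : ZMod p) =
      ∏ k : Fin (p - 1), ∑ x : ZMod p, x ^ ((k : ℕ) + 1) * (x ^ 2 + b * x + c)⁻¹ := by
  set r : Fin (p - 1) → ZMod p := fun i => ((i : ℕ) : ZMod p) + 1 with hr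
  have hr0 : ∀ i, r i ≠ 0 := natCast_add_one_ne_zero_of_fin
  set lam : Fin (p - 1) → ZMod p :=
    fun k => ∑ x : ZMod p, x ^ ((k : ℕ) + 1) * (x ^ 2 + b * x + c)⁻¹ with hlam
  set M : Matrix (Fin (p - 1)) (Fin (p - 1)) (ZMod p) :=
    Matrix.of fun i j => (r i ^ 2 + b * r i * r j + c * r j ^ 2)⁻¹ with hM
  set W : Matrix (Fin (p - 1)) (Fin (p - 1)) (ZMod p) := (Matrix.vandermonde r).transpose with hW
  have hdetM : (sunDet p b c : ZMod p) = M.det := by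
    have := RingHom.map_det (Int.castRingHom (ZMod p)) (Matrix.of fun i j : Fin (p - 1) =>
      ((((i : ℕ) : ℤ) + 1) ^ 2 + b * (((i : ℕ) : ℤ) + 1) * (((j : ℕ) : ℤ) + 1)
        + c * (((j : ℕ) : ℤ) + 1) ^ 2) ^ (p - 2))
    rw [sunDet]
    refine this.trans (congrArg Matrix.det ?_)
    ext i j
    simp [hM, hr, ← zmod_pow_sub_two hp2]
  have hWdet : W.det ≠ 0 := by
    rw [hW, Matrix.det_transpose, Matrix.det_vandermonde_ne_zero_iff]
    intro i j hij
    have h : ((i : ℕ) : ZMod p) = ((j : ℕ) : ZMod p) := add_right_cancel hij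
    rw [ZMod.natCast_eq_natCast_iff'] at h
    have hi := i.2
    have hj := j.2
    rw [Nat.mod_eq_of_lt (by omega), Nat.mod_eq_of_lt (by omega)] at h
    exact Fin.ext h
  -- Substituting `y = x * r j` in the column sum pulls out `r j ^ (k + 1 - 2)`.
  have hmul : W * Matrix.diagonal r * M = Matrix.diagonal lam * W * Matrix.diagonal (fun j => (r j)⁻¹) := by
    ext k j
    rw [Matrix.mul_diagonal, Matrix.diagonal_mul, Matrix.mul_apply]
    have h1 : ∀ i, (W * Matrix.diagonal r) k i * M i j =
        (fun y : ZMod p => y ^ ((k : ℕ) + 1) * (y ^ 2 + b * y * r j + c * r j ^ 2)⁻¹)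
          (((i : ℕ) : ZMod p) + 1) := by
      intro i
      rw [Matrix.mul_diagonal]
      simp [hW, hM, hr, Matrix.vandermonde_apply, pow_succ]
    refine (Finset.sum_congr rfl fun i _ => h1 i).trans ?_
    refine (sum_fin_pred_eq_sum_zmod (fun y : ZMod p =>
      y ^ ((k : ℕ) + 1) * (y ^ 2 + b * y * r j + c * r j ^ 2)⁻¹) (by simp)).trans ?_
    rw [← Equiv.sum_comp (Equiv.mulRight₀ (r j) (hr0 j))]
    simp only [hlam, hW, Matrix.transpose_apply, Matrix.vandermonde_apply, Finset.sum_mul]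
    refine Finset.sum_congr rfl fun x _ => ?_
    have hj := hr0 j
    change (x * r j) ^ ((k : ℕ) + 1) * ((x * r j) ^ 2 + b * (x * r j) * r j + c * r j ^ 2)⁻¹ = _
    rw [show (x * r j) ^ 2 + b * (x * r j) * r j + c * r j ^ 2
      = (x ^ 2 + b * x + c) * r j ^ 2 by ring, mul_inv, mul_pow]
    field_simp
    ring
  have hdet := congrArg Matrix.det hmul
  simp only [Matrix.det_mul, Matrix.det_diagonal] at hdet
  -- By Wilson's theorem the two diagonal factors have the same determinant.
  have hrr : (∏ j, r j) ^ 2 = 1 := by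
    have : (∏ j, r j) = -1 := by
      rw [← ZMod.wilsons_lemma p, ← Finset.prod_range_add_one_eq_factorial, Nat.cast_prod,
        ← Fin.prod_univ_eq_prod_range (fun i => ((i + 1 : ℕ) : ZMod p))]
      simp [hr]
    rw [this]; ring
  have hr1 : (∏ j, r j) ≠ 0 := Finset.prod_ne_zero_iff.2 fun i _ => hr0 i
  rw [Finset.prod_inv_distrib] at hdet
  rw [hdetM]
  have : W.det * M.det = W.det * ∏ k, lam k := by
    calc W.det * M.det = W.det * (∏ j, r j) ^ 2 * M.det := by rw [hrr, mul_one]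
      _ = (∏ j, r j) * (W.det * (∏ j, r j) * M.det) := by ring
      _ = _ := by rw [hdet]; field_simp
  exact mul_left_cancel₀ hWdet this

/-! ### Power sums over the prime field and partial fractions -/

section PartialFractions

variable {p : ℕ} [Fact p.Prime] {K : Type*} [Field K] [Algebra (ZMod p) K]

theorem algebraMap_zmod_ne {a : K} (ha : a ^ p ≠ a) (x : ZMod p) :
    algebraMap (ZMod p) K x - a ≠ 0 := by
  intro h
  rw [sub_eq_zero] at h
  apply ha
  rw [← h, ← map_pow, ZMod.pow_card]

theorem sum_algebraMap_pow_eq_zero {i : ℕ} (hi : i < p - 1) :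
    ∑ x : ZMod p, algebraMap (ZMod p) K x ^ i = 0 := by
  simp only [← map_pow, ← map_sum]
  rw [FiniteField.sum_pow_lt_card_sub_one _ _ (by rwa [ZMod.card]), map_zero]

theorem sum_algebraMap_pow_pred :
    ∑ x : ZMod p, algebraMap (ZMod p) K x ^ (p - 1) = -1 := by
  simp only [← map_pow, ← map_sum]
  have : ∑ x : ZMod p, x ^ (p - 1) = -1 := by
    have hp : 1 ≤ p := (Fact.out : p.Prime).one_lt.le
    simp only [ZMod.pow_card_sub_one]
    rw [Finset.sum_ite, Finset.sum_const_zero, add_zero, Finset.sum_const, Finset.filter_ne',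
      Finset.card_erase_of_mem (Finset.mem_univ _), Finset.card_univ, ZMod.card, nsmul_one,
      Nat.cast_sub hp]
    simp
  rw [this, map_neg, map_one]

/-- Since `x ^ p = x`, dividing `x - a ^ p` by `x - a` leaves a geometric sum; summed over `x`, only
its `x ^ (p - 1)` term survives. -/
theorem sum_inv_algebraMap_sub {a : K} (ha : a ^ p ≠ a) :
    ∑ x : ZMod p, (algebraMap (ZMod p) K x - a)⁻¹ = (a ^ p - a)⁻¹ := by
  have hp := (Fact.out : p.Prime).two_le
  have hcard : ((p : ℕ) : K) = 0 := by
    rw [← map_natCast (algebraMap (ZMod p) K), ZMod.natCast_self, map_zero]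
  refine eq_inv_of_mul_eq_one_left ?_
  rw [Finset.sum_mul]
  have h : ∀ x : ZMod p, (algebraMap (ZMod p) K x - a)⁻¹ * (a ^ p - a) =
      1 - ∑ i ∈ Finset.range p, algebraMap (ZMod p) K x ^ i * a ^ (p - 1 - i) := by
    intro x
    have hx := algebraMap_zmod_ne ha x
    have hg := geom_sum₂_mul (algebraMap (ZMod p) K x) a p
    rw [← map_pow, ZMod.pow_card] at hg
    rw [inv_mul_eq_iff_eq_mul₀ hx]
    linear_combination hg
  rw [Finset.sum_congr rfl fun x _ => h x, Finset.sum_sub_distrib, Finset.sum_comm]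
  simp only [← Finset.sum_mul]
  rw [show Finset.range p = Finset.range (p - 1 + 1) by rw [Nat.sub_add_cancel (by omega)],
    Finset.sum_range_succ, sum_algebraMap_pow_pred,
    Finset.sum_eq_zero (s := Finset.range (p - 1)) fun i hi => by
      rw [sum_algebraMap_pow_eq_zero (Finset.mem_range.1 hi), zero_mul]]
  simp [hcard]

theorem sum_pow_mul_inv_algebraMap_sub {a : K} (ha : a ^ p ≠ a) {k : ℕ} (hk : k ≤ p - 1) :
    ∑ x : ZMod p, algebraMap (ZMod p) K x ^ k * (algebraMap (ZMod p) K x - a)⁻¹ =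
      a ^ k * (a ^ p - a)⁻¹ := by
  induction k with
  | zero => simpa using sum_inv_algebraMap_sub ha
  | succ k ih =>
    have h : ∀ x : ZMod p,
        algebraMap (ZMod p) K x ^ (k + 1) * (algebraMap (ZMod p) K x - a)⁻¹ =
        algebraMap (ZMod p) K x ^ k +
          a * (algebraMap (ZMod p) K x ^ k * (algebraMap (ZMod p) K x - a)⁻¹) := by
      intro x
      have hx := algebraMap_zmod_ne ha x
      field_simp
      ring
    rw [Finset.sum_congr rfl fun x _ => h x, Finset.sum_add_distrib,
      sum_algebraMap_pow_eq_zero (by omega), ← Finset.mul_sum, ih (by omega)]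
    ring

/-- Power sums weighted by the inverse of a quadratic polynomial with conjugate roots `a`, `a'`
outside the prime field. -/
theorem algebraMap_sum_pow_mul_inv_quadratic {a a' : K} (ha : a ^ p = a') (ha' : a' ^ p = a)
    (hne : a' ≠ a) {b c : ZMod p} (hb : algebraMap (ZMod p) K b = -(a + a'))
    (hc : algebraMap (ZMod p) K c = a * a') {k : ℕ} (hk : k ≤ p - 1) :
    algebraMap (ZMod p) K (∑ x : ZMod p, x ^ k * (x ^ 2 + b * x + c)⁻¹) * -(a - a') ^ 2 =
      a ^ k + a' ^ k := by
  have h1 : a ^ p ≠ a := by rwa [ha]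
  have h2 : a' ^ p ≠ a' := by rw [ha']; exact hne.symm
  have e1 := sum_pow_mul_inv_algebraMap_sub h1 hk
  have e2 := sum_pow_mul_inv_algebraMap_sub h2 hk
  have hsub : a - a' ≠ 0 := sub_ne_zero.2 hne.symm
  have hsub' : a' - a ≠ 0 := sub_ne_zero.2 hne
  have h : ∀ x : ZMod p, algebraMap (ZMod p) K (x ^ k * (x ^ 2 + b * x + c)⁻¹) * (a - a') =
      algebraMap (ZMod p) K x ^ k * (algebraMap (ZMod p) K x - a)⁻¹ -
      algebraMap (ZMod p) K x ^ k * (algebraMap (ZMod p) K x - a')⁻¹ := by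
    intro x
    have hx := algebraMap_zmod_ne h1 x
    have hx' := algebraMap_zmod_ne h2 x
    have hq : algebraMap (ZMod p) K (x ^ 2 + b * x + c) =
        (algebraMap (ZMod p) K x - a) * (algebraMap (ZMod p) K x - a') := by
      simp only [map_add, map_mul, map_pow, hb, hc]; ring
    rw [map_mul, map_inv₀, hq, map_pow]
    field_simp
    ring
  have hs : algebraMap (ZMod p) K (∑ x : ZMod p, x ^ k * (x ^ 2 + b * x + c)⁻¹) * (a - a') =
      a ^ k * (a' - a)⁻¹ - a' ^ k * (a - a')⁻¹ := by
    rw [map_sum, Finset.sum_mul, Finset.sum_congr rfl fun x _ => h x, Finset.sum_sub_distrib,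
      e1, e2, ha, ha']
  rw [show ∀ y : K, y * -(a - a') ^ 2 = y * (a - a') * (a' - a) by intro y; ring, hs,
    ← neg_sub a a']
  rw [← neg_sub a a'] at hsub'
  field_simp
  ring

end PartialFractions

/-! ### Arithmetic of `ℚ(√-7)` at an inert prime -/

theorem legendreSym_neg_seven {p : ℕ} [Fact p.Prime] (hp2 : p ≠ 2)
    (h7 : legendreSym 7 (p : ℤ) = -1) : legendreSym p (-7) = -1 := by
  have hodd : p % 2 = 1 := (Fact.out : p.Prime).eq_two_or_odd.resolve_left hp2
  have h := legendreSym.quadratic_reciprocity' (p := p) (q := 7) hp2 (by norm_num)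
  rw [h7, show 7 / 2 = 3 from rfl, pow_mul'] at h
  rw [show (-7 : ℤ) = -1 * 7 by norm_num, legendreSym.mul, legendreSym.at_neg_one hp2,
    ZMod.χ₄_eq_neg_one_pow hodd]
  push_cast at h
  rcases neg_one_pow_eq_or ℤ (p / 2) with h1 | h1 <;> rw [h1] at h ⊢ <;> linarith

/-- A generator of the ring of integers of `ℚ(√-7)`, reduced at an inert prime `p`. -/
theorem exists_root_sq_sub_add_two {p : ℕ} [Fact p.Prime] (hp2 : p ≠ 2)
    (h7 : legendreSym p (-7) = -1) :
    ∃ t : AlgebraicClosure (ZMod p), t ^ 2 = t - 2 ∧ t ^ p = 1 - t := by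
  set K := AlgebraicClosure (ZMod p)
  have : CharP K p := charP_of_injective_algebraMap (algebraMap (ZMod p) K).injective p
  have hodd : p % 2 = 1 := (Fact.out : p.Prime).eq_two_or_odd.resolve_left hp2
  obtain ⟨s, hs⟩ := IsAlgClosed.exists_pow_nat_eq (-7 : K) (n := 2) (by norm_num)
  have h2 : (2 : K) ≠ 0 := Ring.two_ne_zero (by rwa [ringChar.eq K p])
  have hsp : s ^ p = -s := by
    have hl := legendreSym.eq_pow p (-7)
    rw [h7] at hl
    have hl' := congrArg (algebraMap (ZMod p) K) hl
    push_cast at hl'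
    simp only [map_ofNat] at hl'
    calc s ^ p = s ^ (2 * (p / 2) + 1) := by congr 1; omega
      _ = -s := by rw [pow_succ, pow_mul, hs, ← hl']; ring
  have h2p : (2 : K) ^ p = 2 := by
    rw [← map_ofNat (algebraMap (ZMod p) K) 2, ← map_pow, ZMod.pow_card]
  refine ⟨(1 + s) / 2, ?_, ?_⟩
  · field_simp
    linear_combination hs
  · rw [div_pow, add_pow_char, one_pow, hsp, h2p]
    field_simp
    ring

section Conjugates

variable {p : ℕ} [Fact p.Prime] {K : Type*} [Field K] [Algebra (ZMod p) K] {t u : K}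

/-- The ratio of the conjugates `t ^ 4`, `u ^ 4` has odd order. -/
theorem exists_odd_pow_eq (hp2 : p ≠ 2) (h7 : (7 : K) ≠ 0) (htp : t ^ p = u) (hup : u ^ p = t)
    (hadd : t + u = 1) (hmul : t * u = 2) (h16 : ¬ p ≡ 15 [MOD 16]) :
    ∃ m, Odd m ∧ (-t ^ 4) ^ m = (-u ^ 4) ^ m := by
  have hodd : p % 2 = 1 := (Fact.out : p.Prime).eq_two_or_odd.resolve_left hp2
  have hnorm : t ^ (p + 1) = u ^ (p + 1) := by
    rw [pow_succ, pow_succ, htp, hup, mul_comm]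
  have key : ∀ m, Odd m → t ^ (4 * m) = u ^ (4 * m) → (-t ^ 4) ^ m = (-u ^ 4) ^ m := by
    intro m hm h
    rw [hm.neg_pow, hm.neg_pow, ← pow_mul, ← pow_mul, h]
  have h16' : p % 16 ≠ 15 := h16
  have hcases : p % 4 = 1 ∨ p % 8 = 3 ∨ p % 16 = 7 := by omega
  -- `t / u` has order dividing `p + 1`; the first two cases need only this. For `p ≡ 7 (mod 16)`
  -- another factor 2 must be gained.
  rcases hcases with h | h | h
  · have hm : Odd ((p + 1) / 2) := Nat.odd_iff.2 (by omega)
    refine ⟨_, hm, key _ hm ?_⟩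
    rw [show 4 * ((p + 1) / 2) = (p + 1) * 2 by omega, pow_mul, pow_mul, hnorm]
  · have hm : Odd ((p + 1) / 4) := Nat.odd_iff.2 (by omega)
    refine ⟨_, hm, key _ hm ?_⟩
    rw [show 4 * ((p + 1) / 4) = p + 1 by omega, hnorm]
  · have hm : Odd ((p + 1) / 8) := Nat.odd_iff.2 (by omega)
    refine ⟨_, hm, key _ hm ?_⟩
    rw [show 4 * ((p + 1) / 8) = (p + 1) / 2 by omega]
    have : CharP K p := charP_of_injective_algebraMap (algebraMap (ZMod p) K).injective p
    obtain ⟨s', hs'⟩ : IsSquare (2 : ZMod p) :=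
      (ZMod.exists_sq_eq_two_iff hp2).2 (Or.inr (by omega))
    set s := algebraMap (ZMod p) K s' with hsdef
    have hs : s ^ 2 = 2 := by
      rw [hsdef, ← map_pow, sq, ← hs', map_ofNat]
    have hsp : s ^ p = s := by rw [hsdef, ← map_pow, ZMod.pow_card]
    have hc : (1 + 2 * s) ≠ 0 := by
      intro h0
      apply h7
      linear_combination (2 * s - 1) * h0 - 4 * hs
    have e : ∀ {x y : K}, x ^ p = y → x + y = 1 → x * y = 2 →
        x ^ ((p + 1) / 2) * (1 + 2 * s) ^ ((p + 1) / 2) = (x + s) * (y + s) := by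
      intro x y hxp hxy hxy2
      -- Up to the common factor `1 + 2 * s`, fixed by Frobenius, `x` is a square, so its `(p + 1) /
      -- 2`-th power is a norm, symmetric in `x` and `y`.
      have hsq : (x + s) ^ 2 = x * (1 + 2 * s) := by
        linear_combination x * hxy - hxy2 + hs
      rw [← mul_pow, ← hsq, ← pow_mul, show 2 * ((p + 1) / 2) = p + 1 by omega, pow_succ,
        add_pow_char, hxp, hsp, mul_comm]
    have e1 := e htp hadd hmul
    have e2 := e hup (by rw [add_comm, hadd]) (by rw [mul_comm, hmul])
    refine mul_right_cancel₀ (pow_ne_zero ((p + 1) / 2) hc) ?_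
    rw [e1, e2, mul_comm]

/-- An element `a / b` of odd order has no power equal to -1. -/
theorem pow_add_pow_ne_zero_of_odd {a b : K} (h2 : (2 : K) ≠ 0) (hb : b ≠ 0) {m : ℕ} (hm : Odd m)
    (hab : a ^ m = b ^ m) (k : ℕ) : a ^ k + b ^ k ≠ 0 := by
  intro h
  have h1 : a ^ k = -b ^ k := eq_neg_of_add_eq_zero_left h
  have h3 : b ^ (m * k) = -b ^ (m * k) := by
    calc b ^ (m * k) = (a ^ k) ^ m := by rw [pow_mul, ← hab, ← pow_mul, ← pow_mul, mul_comm]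
      _ = -b ^ (m * k) := by rw [h1, hm.neg_pow, ← pow_mul, mul_comm]
  have h4 : 2 * b ^ (m * k) = 0 := by linear_combination h3
  exact mul_ne_zero h2 (pow_ne_zero _ hb) h4

end Conjugates

/-- If `v` is symmetric under `k ↦ p + 1 - k` up to squares, then only the terms `k = 1` and
`k = (p + 1) / 2` contribute to the quadratic character of `v 1 ⋯ v (p - 1)`. -/
theorem quadraticChar_prod_of_symm {p : ℕ} [Fact p.Prime] (hp5 : 5 ≤ p) (v : ℕ → ZMod p)
    (hv : ∀ k, 1 ≤ k → k < p → v k ≠ 0)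
    (hsymm : ∀ k, 2 ≤ k → k < p → ∃ w, v k = v (p + 1 - k) * w ^ 2) :
    quadraticChar (ZMod p) (∏ k : Fin (p - 1), v (k + 1)) =
      quadraticChar (ZMod p) (v 1 * v ((p + 1) / 2)) := by
  have hodd : p % 2 = 1 := (Fact.out : p.Prime).eq_two_or_odd.resolve_left (by omega)
  set f : ℕ → ℤ := fun k => quadraticChar (ZMod p) (v k) with hf
  have h1 : 1 ∈ Finset.Ico 1 p := Finset.mem_Ico.2 (by omega)
  have hM : (p + 1) / 2 ∈ (Finset.Ico 1 p).erase 1 :=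
    Finset.mem_erase.2 ⟨by omega, Finset.mem_Ico.2 (by omega)⟩
  have hrest : ∏ k ∈ ((Finset.Ico 1 p).erase 1).erase ((p + 1) / 2), f k = 1 := by
    have hmem : ∀ k ∈ ((Finset.Ico 1 p).erase 1).erase ((p + 1) / 2),
        2 ≤ k ∧ k < p ∧ k ≠ (p + 1) / 2 := by
      intro k hk
      simp only [Finset.mem_erase, Finset.mem_Ico] at hk
      omega
    refine Finset.prod_involution (fun k _ => p + 1 - k) ?_ ?_ ?_ ?_
    · intro k hk
      obtain ⟨hk2, hkp, -⟩ := hmem k hk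
      obtain ⟨w, hw⟩ := hsymm k hk2 hkp
      have hne := hv k (by omega) hkp
      have h0 : v (p + 1 - k) * w ≠ 0 := by
        intro h0
        apply hne
        rw [hw, sq, ← mul_assoc, h0, zero_mul]
      simp only [hf]
      rw [← map_mul, show v k * v (p + 1 - k) = (v (p + 1 - k) * w) ^ 2 by rw [hw]; ring]
      exact quadraticChar_sq_one' h0
    · intro k hk _
      have := hmem k hk
      omega
    · intro k hk
      have := hmem k hk
      simp only [Finset.mem_erase, Finset.mem_Ico]
      omega
    · intro k hk
      have := hmem k hk
      omega
  rw [map_prod, Fin.prod_univ_eq_prod_range (fun k => quadraticChar (ZMod p) (v (k + 1))) (p - 1),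
    Finset.range_eq_Ico, Finset.prod_Ico_add' (fun k => quadraticChar (ZMod p) (v k)) 0 (p - 1) 1,
    zero_add, Nat.sub_add_cancel (by omega), map_mul, ← Finset.mul_prod_erase _ _ h1,
    ← Finset.mul_prod_erase _ _ hM, hrest, mul_one]

theorem theorem1p3 (p : ℕ) [Fact p.Prime] (hp2 : p ≠ 2) (hp3 : p ≠ 3)
    (h7 : legendreSym 7 (p : ℤ) = -1) (h16 : ¬ p ≡ 15 [MOD 16]) :
    legendreSym p (sunDet p 1 16) = legendreSym p (-2) := by
  have hprime : p.Prime := Fact.out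
  have hodd : p % 2 = 1 := hprime.eq_two_or_odd.resolve_left hp2
  have hp5 : 5 ≤ p := by
    have := hprime.two_le
    by_contra hlt
    interval_cases p <;> simp_all
  have hl7 := legendreSym_neg_seven hp2 h7
  set K := AlgebraicClosure (ZMod p)
  obtain ⟨t, ht, htp⟩ : ∃ t : K, t ^ 2 = t - 2 ∧ t ^ p = 1 - t :=
    exists_root_sq_sub_add_two hp2 hl7
  have : CharP K p := charP_of_injective_algebraMap (algebraMap (ZMod p) K).injective p
  obtain ⟨u, hu⟩ : ∃ u : K, u = 1 - t := ⟨_, rfl⟩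
  have hadd : t + u = 1 := by rw [hu]; ring
  have hmul : t * u = 2 := by rw [hu]; linear_combination -ht
  rw [← hu] at htp
  have hup : u ^ p = t := by rw [hu, sub_pow_char, one_pow, htp, hu]; ring
  have hinj := (algebraMap (ZMod p) K).injective
  have h2 : (2 : ZMod p) ≠ 0 := Ring.two_ne_zero (by rwa [ZMod.ringChar_zmod_n])
  have h3 : (3 : ZMod p) ≠ 0 := by
    intro h
    have h' : ((3 : ℕ) : ZMod p) = 0 := by exact_mod_cast h
    rw [ZMod.natCast_eq_zero_iff] at h'
    exact hp3 ((Nat.prime_dvd_prime_iff_eq hprime Nat.prime_three).1 h')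
  have h7z : (7 : ZMod p) ≠ 0 := by
    intro h
    have h0 : legendreSym p (-7) = 0 := by
      rw [legendreSym.eq_zero_iff]
      push_cast
      rw [h, neg_zero]
    rw [h0] at hl7
    norm_num at hl7
  have h2K : (2 : K) ≠ 0 := by
    intro h; exact h2 (hinj (by rw [map_ofNat, map_zero, h]))
  have h7K : (7 : K) ≠ 0 := by
    intro h; exact h7z (hinj (by rw [map_ofNat, map_zero, h]))
  have h63 : (63 : ZMod p) ≠ 0 := by
    rw [show (63 : ZMod p) = 3 ^ 2 * 7 by norm_num]
    exact mul_ne_zero (pow_ne_zero _ h3) h7z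
  obtain ⟨a, ha⟩ : ∃ a : K, a = -t ^ 4 := ⟨_, rfl⟩
  obtain ⟨b, hb⟩ : ∃ b : K, b = -u ^ 4 := ⟨_, rfl⟩
  have hpodd : Odd p := Nat.odd_iff.2 hodd
  have hap : a ^ p = b := by
    rw [ha, hb, hpodd.neg_pow, ← pow_mul, mul_comm, pow_mul, htp]
  have hbp : b ^ p = a := by
    rw [ha, hb, hpodd.neg_pow, ← pow_mul, mul_comm, pow_mul, hup]
  have hab : a * b = 16 := by
    rw [ha, hb, show -t ^ 4 * -u ^ 4 = (t * u) ^ 4 by ring, hmul]; norm_num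
  have ha' : a = 3 * t - 2 := by
    rw [ha]; linear_combination (-t ^ 2 - t + 1) * ht
  have hu2 : u ^ 2 = u - 2 := by linear_combination u * hadd - hmul
  have hb' : b = 3 * u - 2 := by
    rw [hb]; linear_combination (-u ^ 2 - u + 1) * hu2
  have hsum : a + b = -1 := by rw [ha', hb']; linear_combination 3 * hadd
  have hdiff : -(a - b) ^ 2 = 63 := by linear_combination (-a - b + 1) * hsum + 4 * hab
  have hne : b ≠ a := by
    intro h
    rw [h] at hdiff
    apply h63
    apply hinj
    rw [map_ofNat, map_zero, ← hdiff]
    ring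
  have hb0 : b ≠ 0 := by
    intro h
    rw [h, mul_zero, show (16 : K) = 2 ^ 4 by norm_num] at hab
    exact pow_ne_zero _ h2K hab.symm
  -- The factor 63 clears denominators and is harmless: `63 ^ (p - 1) = 1`.
  obtain ⟨v, hv⟩ : ∃ v : ℕ → ZMod p, ∀ k, v k =
      (∑ x : ZMod p, x ^ k * (x ^ 2 + ((1 : ℤ) : ZMod p) * x + ((16 : ℤ) : ZMod p))⁻¹) * 63 :=
    ⟨_, fun _ => rfl⟩
  have hvK : ∀ k, k < p → algebraMap (ZMod p) K (v k) = a ^ k + b ^ k := by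
    intro k hk
    rw [← algebraMap_sum_pow_mul_inv_quadratic hap hbp hne (b := ((1 : ℤ) : ZMod p))
      (c := ((16 : ℤ) : ZMod p)) (by rw [hsum, Int.cast_one, map_one, neg_neg])
      (by rw [hab, Int.cast_ofNat, map_ofNat]) (by omega : k ≤ p - 1), hdiff,
      hv, map_mul, map_ofNat]
  obtain ⟨m, hm, hmab⟩ := exists_odd_pow_eq hp2 h7K htp hup hadd hmul h16
  rw [← ha, ← hb] at hmab
  have hvne : ∀ k, 1 ≤ k → k < p → v k ≠ 0 := by
    intro k _ hk h0
    have h := hvK k hk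
    rw [h0, map_zero] at h
    exact pow_add_pow_ne_zero_of_odd h2K hb0 hm hmab k h.symm
  have hsymm : ∀ k, 2 ≤ k → k < p → ∃ w, v k = v (p + 1 - k) * w ^ 2 := by
    intro k hk2 hkp
    -- The square of this witness is `(a * b) ^ (k - 1)`; Frobenius turns `a` into `b ^ p`.
    refine ⟨4 ^ (k - 1), hinj ?_⟩
    rw [map_mul, hvK k hkp, hvK _ (by omega), ← pow_mul, mul_comm (k - 1), pow_mul, map_pow,
      show ((4 : ZMod p) ^ 2) = 16 by norm_num, map_ofNat, ← hab]
    obtain ⟨j, rfl⟩ : ∃ j, k = j + 1 := ⟨k - 1, by omega⟩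
    have hpj : p + 1 - (j + 1) + j = p := by omega
    rw [Nat.add_sub_cancel, mul_pow, pow_succ' a j, pow_succ' b j]
    calc a * a ^ j + b * b ^ j = b ^ (p + 1 - (j + 1) + j) * a ^ j +
          a ^ (p + 1 - (j + 1) + j) * b ^ j := by rw [hpj, hap, hbp]
      _ = _ := by rw [pow_add, pow_add]; ring
  have hv1 : v 1 = -1 := hinj (by rw [hvK 1 (by omega), pow_one, pow_one, hsum, map_neg, map_one])
  have hvM : v ((p + 1) / 2) = (-1) ^ ((p + 1) / 2) * (2 * 2 ^ 2) := by
    apply hinj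
    have h4 : 4 * ((p + 1) / 2) = (p + 1) * 2 := by omega
    rw [hvK _ (by omega), ha, hb, neg_pow, neg_pow (u ^ 4), ← pow_mul, ← pow_mul, h4, pow_mul,
      pow_mul, pow_succ t, pow_succ u, htp, hup, mul_comm u t, hmul]
    simp only [map_mul, map_pow, map_neg, map_one, map_ofNat]
    ring
  have hD : ((sunDet p 1 16 : ℤ) : ZMod p) = ∏ k : Fin (p - 1), v (k + 1) := by
    simp only [hv]
    rw [sunDet_cast hp2, Finset.prod_mul_distrib, Finset.prod_const, Finset.card_univ,
      Fintype.card_fin, ZMod.pow_card_sub_one_eq_one h63, mul_one]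
  rw [legendreSym, legendreSym, hD, quadraticChar_prod_of_symm hp5 v hvne hsymm, hv1, hvM]
  rw [show ((-2 : ℤ) : ZMod p) = -1 * 2 by push_cast; ring]
  simp only [map_mul, map_pow]
  have hsq : quadraticChar (ZMod p) 2 ^ 2 = 1 := quadraticChar_sq_one h2
  rw [hsq, mul_one, ← mul_assoc, ← pow_succ']
  congr 1
  -- Either -1 is a square, or the exponent of its character is odd.
  rcases (by omega : p % 4 = 1 ∨ p % 4 = 3) with h | h
  · have : quadraticChar (ZMod p) (-1) = 1 := by
      have := legendreSym.at_neg_one hp2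
      rw [ZMod.χ₄_nat_one_mod_four h, legendreSym] at this
      exact_mod_cast this
    rw [this, one_pow]
  · have hsq' : quadraticChar (ZMod p) (-1) ^ 2 = 1 := quadraticChar_sq_one (by simp)
    rw [show (p + 1) / 2 + 1 = 2 * ((p + 1) / 4) + 1 by omega, pow_succ, pow_mul, hsq', one_pow,
      one_mul]
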